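/- **Setting.** Consider finite two-player zero-sum extensive-form games with chance moves and perfect recall, with information sets $S=S_1\cup S_2$, action sets $A(s)$, and expected payoffs $v_i(\pi)$ of behaviour strategy profiles $\pi$. A profile $\pi$ is an $\epsilon$-NE if for each player $i$, $\max_{\pi_i'}v_i(\pi_i',\pi_{-i})-\epsilon\le v_i(\pi)\le \min_{\pi_{-i}'}v_i(\pi_i,\pi_{-i}')+\epsilon$. For a population $\Pi$ (a nonempty set $\Pi(s)\subseteq A(s)$ for every $s$), the restricted game $\mathbf G(\Pi)$ keeps only the actions in $\Pi$; $S_i(\Pi)$ is the set of information sets of player $i$ that occur in it, $|\mathbf G(\Pi)|=\sum_i|S_i(\Pi)|$ its size, and $|A(\Pi)|$ its largest number of actions at an information set. The average of profiles $\pi^t$, $t\in\tau$, is the realization-weighted average $\bar\pi(s,a)=\sum_{t\in\tau}x^{t}(s)\pi^t(s,a)/\sum_{t\in\tau}x^{t}(s)$, where $x^t(s)$ is the contribution under $\pi^t$ of the player acting at $s$ to the probability of reaching $s$ (and the unweighted average where the denominator is $0$). **Regret minimizer.** Started afresh in $\mathbf G(\Pi)$, for every $\Pi$, a regret minimizer produces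 profiles $\sigma^1,\sigma^2,\dots$ of $\mathbf G(\Pi)$. It has $\tilde{\mathcal O}(|S_i|\sqrt{|A|T})$ regret, with constants $c>0$ and $p\in\mathbb N$, if for all $\Pi$, $i$, $n$ and all strategies $\pi_i$ of $\mathbf G(\Pi)$, $$\sum_{t=1}^n\big(v_i(\pi_i,\sigma^t_{-i})-v_i(\sigma^t)\big)\le c\,|S_i(\Pi)|\sqrt{|A(\Pi)|\,n}\;\log^p\!\big(e+|S_i(\Pi)||A(\Pi)|n\big).$$ **RMDO** with frequency function $m:\mathbb N\to\mathbb N^+$. Let $\Pi_1$ consist of pure best responses of both players to the uniformly random profile, and start window $0$. In iteration $t=1,2,\dots$, in window $j$, let $\pi^t$ be the next iterate of the regret minimizer in $\mathbf G_t=\mathbf G(\Pi_t)$. If $m(j)$ divides $t$, add to $\Pi_t$ the actions of pure best responses, in the original game, of both players to the average of the profiles of window $j$ so far (ties broken arbitrarily); this gives $\Pi_{t+1}$. If $\Pi_{t+1}\ne\Pi_t$, start window $j+1$ and restart the regret minimizer. If $m(j)$ does not divide $t$, let $\Pi_{t+1}=\Pi_t$. An iteration costs $|\mathbf G_t|$ samples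 for regret minimization, and a further $|\mathbf G_t|$ samples if best responses are computed. **XODO** (Extensive-form Online Double Oracle) is the same procedure with best responses computed and added in every iteration; its output after $T$ iterations is the overall average $\bar\pi^T$ of $\pi^1,\dots,\pi^T$. Write $k_T$ for the number of windows among iterations $1,\dots,T$, $X_T=|\mathbf G_T|$ for the size of the last restricted game, and $N_T$ for the number of samples used in iterations $1,\dots,T$. **Proposition (XODO sample complexity).** 1. XODO is exactly RMDO with $m\equiv1$. 2. Given a regret minimizer with $\tilde{\mathcal O}(|S_i|\sqrt{|A|T})$ regret, XODO reaches an $\epsilon$-NE with sample complexity $\tilde{\mathcal O}(2k^2X^3/\epsilon^2)$. Precisely: for all $c,\Delta>0$ and $p\in\mathbb N$ there are $C>0$ and $q\in\mathbb N$ such that for every such game whose payoffs differ by at most $\Delta$, every regret minimizer for it with constants $c,p$, every run of XODO and every $0<\epsilon\le\Delta$, with $$B_T=C\cdot\frac{2k_T^2X_T^3}{\epsilon^2}\cdot\log^q\!\Big(e+\frac{k_TX_T}{\epsilon}\Big),$$ (a) for every $T\ge1$, if $N_T\ge B_T$ then $\bar\pi^T$ is an $\epsilon$-NE; (b) there is a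 first $T\ge1$ such that $\bar\pi^T$ is an $\epsilon$-NE, and for this $T$, $N_T\le B_T$. -/

import Mathlib

universe u v

namespace DoubleOracle

/-- Finite game trees. `S` is the set of information sets of the two players and `A s` the set of
actions available at the information set `s` (hence at every history in `s`). Leaves carry the
payoff of player `0`; a chance node carries the probability distribution of its outcomes. -/
inductive GameTree {S : Type u} (A : S → Type v) : Type (max u v)
  | terminal (payoff : ℝ) : GameTree A
  | chance (n : ℕ) (p : stdSimplex ℝ (Fin n)) (next : Fin n → GameTree A) : GameTree A
  | decision (s : S) (next : A s → GameTree A) : GameTree A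

/-- A (not yet normalised) assignment of weights to the actions at all information sets. It
describes a joint strategy: the part of player `i` is its restriction to the information sets
owned by `i`. -/
abbrev Profile {S : Type u} (A : S → Type v) := (s : S) → A s → ℝ

/-- A population: the actions available at each information set of the restricted game. -/
abbrev Population {S : Type u} (A : S → Type v) := (s : S) → Set (A s)

/-- A joint pure strategy. -/
abbrev PureProfile {S : Type u} (A : S → Type v) := (s : S) → A s

section
variable {S : Type u} {A : S → Type v}

namespace GameTree

/-- The set of payoffs of player `0` at the terminal histories. -/
def payoffs : GameTree A → Set ℝ
  | terminal x => {x}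
  | chance _ _ next => ⋃ c, (next c).payoffs
  | decision _ next => ⋃ a, (next a).payoffs

/-- Expected payoff of player `0` under the joint strategy `π`. -/
noncomputable def value [∀ s, Fintype (A s)] (π : Profile A) : GameTree A → ℝ
  | terminal x => x
  | chance n p next => ∑ c : Fin n, p.1 c * (next c).value π
  | decision s next => ∑ a : A s, π s a * (next a).value π

/-- The information sets having a history that remains in the tree when at each information set
`s` only the actions in `B s` are kept. -/
def visited (B : Population A) : GameTree A → Set S
  | terminal _ => ∅
  | chance _ _ next => ⋃ c, (next c).visited B
  | decision s next => {s} ∪ ⋃ a ∈ B s, (next a).visited B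

/-- Perfect recall below a node at which player `i` has the own record `hist i` (earlier own
information sets with the action taken there, latest first): at each decision node, the record
of the acting player is determined by the information set, namely it is `past s`. -/
def Recalls (owner : S → Fin 2) (past : S → List (Σ s, A s)) :
    (Fin 2 → List (Σ s, A s)) → GameTree A → Prop
  | _, terminal _ => True
  | hist, chance _ _ next => ∀ c, (next c).Recalls owner past hist
  | hist, decision s next =>
      past s = hist (owner s) ∧
        ∀ a, (next a).Recalls owner past
          (Function.update hist (owner s) (⟨s, a⟩ :: hist (owner s)))

end GameTree

/-- Two-player zero-sum extensive-form games with chance and perfect recall. `owner s` is the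
player who acts at `s`, and `past s` the sequence of information sets and actions of that player
which leads to `s`, latest first. -/
structure Game {S : Type u} (A : S → Type v) where
  owner : S → Fin 2
  root : GameTree A
  past : S → List (Σ s, A s)
  perfect_recall : root.Recalls owner past (fun _ => [])

/-- Behaviour strategies: a probability distribution on the actions of each information set. -/
def IsStrategy [∀ s, Fintype (A s)] (π : Profile A) : Prop :=
  ∀ s, π s ∈ stdSimplex ℝ (A s)

/-- Strategies of the restricted game, extended by zero to the other actions. -/
def IsStrategyIn [∀ s, Fintype (A s)] (B : Population A) (π : Profile A) : Prop :=
  IsStrategy π ∧ ∀ s, ∀ a, a ∉ B s → π s a = 0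

/-- The uniformly random strategy. -/
noncomputable def uniformStrategy (A : S → Type v) [∀ s, Fintype (A s)] : Profile A :=
  fun s _ => 1 / (Fintype.card (A s) : ℝ)

open Classical in
/-- A joint pure strategy as a behaviour strategy. -/
noncomputable def PureProfile.toProfile (σ : PureProfile A) : Profile A :=
  fun s a => if a = σ s then 1 else 0

namespace Game

/-- The joint strategy in which player `i` plays according to `π'` and the opponent according
to `π`. -/
def deviate (G : Game A) (i : Fin 2) (π' π : Profile A) : Profile A :=
  fun s => if G.owner s = i then π' s else π s

section
variable [∀ s, Fintype (A s)]

/-- Expected payoff of player `i`. -/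
noncomputable def value (G : Game A) (i : Fin 2) (π : Profile A) : ℝ :=
  if i = 0 then G.root.value π else - G.root.value π

/-- `ε`-Nash equilibrium: no player gains more than `ε` by deviating, and no player loses more
than `ε` by a deviation of the opponent. -/
def IsNash (G : Game A) (ε : ℝ) (π : Profile A) : Prop :=
  IsStrategy π ∧ ∀ i : Fin 2, ∀ π', IsStrategy π' →
    G.value i (G.deviate i π' π) - ε ≤ G.value i π ∧
    G.value i π ≤ G.value i (G.deviate (1 - i) π' π) + ε

/-- The part of player `i` of the pure profile `σ` is a best response, among all strategies of
the original game, to the strategy of the opponent in `π`. -/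
def IsBestResponse (G : Game A) (i : Fin 2) (σ : PureProfile A) (π : Profile A) : Prop :=
  ∀ π', IsStrategy π' → G.value i (G.deviate i π' π) ≤ G.value i (G.deviate i σ.toProfile π)

end

/-- Contribution of the owner of `s` to the probability of reaching `s`; by perfect recall it is
the same for all histories in `s`. -/
def reach (G : Game A) (π : Profile A) (s : S) : ℝ :=
  ((G.past s).map fun e => π e.1 e.2).prod

open Classical in
/-- The average strategy of the profiles `strat t`, `t ∈ τ`, as in counterfactual regret
minimization: at `s` the profiles are weighted by the owner's probability of reaching `s`, so
that it is equivalent to choosing `t ∈ τ` uniformly at the start and playing `strat t`. Where all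
the weights vanish the unweighted average is taken (this does not affect any payoff). -/
noncomputable def average (G : Game A) (strat : ℕ → Profile A) (τ : Finset ℕ) : Profile A :=
  fun s a =>
    if ∑ t ∈ τ, G.reach (strat t) s = 0 then
      (∑ t ∈ τ, strat t s a) / (τ.card : ℝ)
    else
      (∑ t ∈ τ, G.reach (strat t) s * strat t s a) / ∑ t ∈ τ, G.reach (strat t) s

/-- Number of information sets of player `i` in the restricted game. -/
noncomputable def sizeOf (G : Game A) (i : Fin 2) (B : Population A) : ℕ :=
  {s | s ∈ G.root.visited B ∧ G.owner s = i}.ncard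

/-- Size of the restricted game: number of information sets of both players in it. -/
noncomputable def size (G : Game A) (B : Population A) : ℕ :=
  ∑ i : Fin 2, G.sizeOf i B

open Classical in
/-- Largest number of actions at an information set of the restricted game. -/
noncomputable def maxActions [Fintype S] (G : Game A) (B : Population A) : ℕ :=
  (Finset.univ.filter fun s => s ∈ G.root.visited B).sup fun s => (B s).ncard

end Game

/-- The logarithmic factors suppressed in the notation `Õ`. -/
noncomputable def polylog (p : ℕ) (x : ℝ) : ℝ :=
  (Real.log (Real.exp 1 + x)) ^ p

/-- `rm B n` is the profile played in round `n = 0, 1, 2, …` when the minimizer is started afresh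
for both players in the restricted game with population `B`. In each such game its iterates are
strategies of the restricted game, and for both players and every number `n` of rounds the
cumulative regret within the restricted game is
at most `c |S_i| √(|A| n)` up to the power `p` of a logarithm, where `|S_i|` and `|A|` are those
of the restricted game. -/
structure IsRegretMinimizer [Fintype S] [∀ s, Fintype (A s)] (G : Game A) (c : ℝ) (p : ℕ)
    (rm : Population A → ℕ → Profile A) : Prop where
  isStrategyIn : ∀ B : Population A, (∀ s, (B s).Nonempty) → ∀ n, IsStrategyIn B (rm B n)
  regret_le : ∀ B : Population A, (∀ s, (B s).Nonempty) → ∀ (i : Fin 2) (n : ℕ) (π : Profile A),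
    IsStrategyIn B π →
      ∑ t ∈ Finset.range n, (G.value i (G.deviate i π (rm B t)) - G.value i (rm B t)) ≤
        c * G.sizeOf i B * √(G.maxActions B * n) *
          polylog p (G.sizeOf i B * G.maxActions B * n)

/-- Record of an execution of a double oracle algorithm: in iteration `t ≥ 1`, `pop t` is the
population, `win t` the index of the time window, `strat t` the profile played, and `br t` the
best responses of both players, if computed. Index `0` is the initialization. -/
structure Run {S : Type u} (A : S → Type v) where
  pop : ℕ → Population A
  win : ℕ → ℕ
  strat : ℕ → Profile A
  br : ℕ → PureProfile A

namespace Run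

/-- The iterations up to `t` in the time window of `t`. -/
def window (r : Run A) (t : ℕ) : Finset ℕ :=
  (Finset.Icc 1 t).filter fun t' => r.win t' = r.win t

/-- The average strategy over the iterations up to `t` in the current window. -/
noncomputable def windowAverage (r : Run A) (G : Game A) (t : ℕ) : Profile A :=
  G.average r.strat (r.window t)

/-- The overall average strategy after `T` iterations. -/
noncomputable def overallAverage (r : Run A) (G : Game A) (T : ℕ) : Profile A :=
  G.average r.strat (Finset.Icc 1 T)

/-- The number of time windows among the first `T` iterations. -/
def numWindows (r : Run A) (T : ℕ) : ℕ :=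
  ((Finset.Icc 1 T).image r.win).card

/-- Number of information sets processed in the first `T` iterations: an iteration of regret
minimization traverses the current restricted game, and a computation of best responses is
charged the size of the current restricted game as well. -/
noncomputable def samples (r : Run A) (G : Game A) (m : ℕ → ℕ+) (T : ℕ) : ℕ :=
  ∑ t ∈ Finset.Icc 1 T,
    (G.size (r.pop t) + if t % (m (r.win t) : ℕ) = 0 then G.size (r.pop t) else 0)

/-- Initialization: the population consists of best responses to the uniform strategy. -/
structure IsInit [∀ s, Fintype (A s)] (G : Game A) (r : Run A) : Prop where
  strat_zero : r.strat 0 = uniformStrategy A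
  br_zero : ∀ i, G.IsBestResponse i (r.br 0) (r.strat 0)
  pop_one : ∀ s, r.pop 1 s = {r.br 0 s}
  win_one : r.win 1 = 0

/-- The profile of iteration `t` is the next iterate of the regret minimizer in the current
restricted game; the minimizer is restarted at the beginning of each window. -/
def Minimizes (rm : Population A → ℕ → Profile A) (r : Run A) (t : ℕ) : Prop :=
  r.strat t = rm (r.pop t) ((r.window t).card - 1)

/-- Best responses of both players, in the original game, to the current window average are
computed and merged into the population. A new window starts if this changes the population. -/
structure Expands [∀ s, Fintype (A s)] (G : Game A) (r : Run A) (t : ℕ) : Prop where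
  isBestResponse : ∀ i, G.IsBestResponse i (r.br t) (r.windowAverage G t)
  pop_succ : ∀ s, r.pop (t + 1) s = r.pop t s ∪ {r.br t s}
  win_same : r.pop (t + 1) = r.pop t → r.win (t + 1) = r.win t
  win_new : r.pop (t + 1) ≠ r.pop t → r.win (t + 1) = r.win t + 1

/-- `r` is an execution of Regret-Minimizing Double Oracle with frequency function `m`; ties
between best responses may be broken in any way. -/
structure IsRMDO [∀ s, Fintype (A s)] (G : Game A) (rm : Population A → ℕ → Profile A)
    (m : ℕ → ℕ+) (r : Run A) : Prop where
  init : r.IsInit G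
  minimize : ∀ t, 1 ≤ t → r.Minimizes rm t
  expand : ∀ t, 1 ≤ t → t % (m (r.win t) : ℕ) = 0 → r.Expands G t
  keep : ∀ t, 1 ≤ t → t % (m (r.win t) : ℕ) ≠ 0 →
    r.pop (t + 1) = r.pop t ∧ r.win (t + 1) = r.win t

/-- `r` is an execution of Extensive-form Online Double Oracle: every iteration performs one step
of regret minimization and then merges best responses to the window average. -/
structure IsXODO [∀ s, Fintype (A s)] (G : Game A) (rm : Population A → ℕ → Profile A)
    (r : Run A) : Prop where
  init : r.IsInit G
  step : ∀ t, 1 ≤ t → r.Minimizes rm t ∧ r.Expands G t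

end Run

end

end DoubleOracle

/-!
The argument is the reduction of equilibria to regret, with windows.

* *Averages and regret.* Perfect recall makes the realization-weighted average of profiles
  payoff-equivalent to choosing one of them uniformly at random
  (`GameTree.sum_mul_value_deviate_average`, `Game.card_mul_value_deviate_average`). As the game is
  zero-sum, the average is therefore an `ε`-Nash equilibrium as soon as the regrets of the two
  players sum to at most `ε` per round (`Game.isNash_average`).
* *Regret within a window.* As long as a window continues, the best responses to its average lie in
  the population, so that the regret against all strategies of the original game is at most the
  regret in the restricted game, which the regret minimizer bounds. Only the last iteration of a
  window escapes this argument, and it costs at most the range `Δ` of the payoffs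
  (`Run.IsXODO.regret_window_le`).
* *Total regret.* A window adds at most one action at each information set, hence all populations
  have at most `k` actions per information set. Summing over the `k` windows with the
  Cauchy-Schwarz inequality gives regret `k Δ + c k X √T polylog (X k T)` for each player
  (`Run.IsXODO.regret_le`). It falls below `ε T / 2` once `T` is of the order of `(k X / ε) ^ 2` up
  to logarithms (`exists_rounds_bound`).
* *Samples.* An iteration uses at most `2 X` samples, so the bound on the samples forces `T` to be
  that large. The number of windows is bounded because the game is finite, so the bound is
  eventually met; minimality of the first equilibrium and the cost of one further iteration give the
  upper bound on its samples (`Run.IsXODO.exists_isLeast_isNash`).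
-/

namespace DoubleOracle

variable {S : Type u} {A : S → Type v}

/-! ### Values of game trees -/

namespace GameTree

theorem visited_mono {B B' : Population A} (h : ∀ s, B s ⊆ B' s) :
    ∀ g : GameTree A, g.visited B ⊆ g.visited B'
  | terminal _ => subset_rfl
  | chance _ _ next => Set.iUnion_mono fun c => visited_mono h (next c)
  | decision s next =>
      Set.union_subset_union_right _ <|
        Set.biUnion_mono (h s) fun a _ => visited_mono h (next a)

/-- If no information set is visited, the tree has no decision node at all, whatever the
population. -/
theorem visited_eq_empty {B : Population A} (B' : Population A) :
    ∀ g : GameTree A, g.visited B = ∅ → g.visited B' = ∅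
  | terminal _, _ => rfl
  | chance _ _ next, h => by
      simp only [visited, Set.iUnion_eq_empty] at h ⊢
      exact fun c => visited_eq_empty B' (next c) (h c)
  | decision s next, h => absurd h (Set.insert_nonempty s _).ne_empty

variable [∀ s, Fintype (A s)]

theorem value_eq_of_visited_eq_empty {B : Population A} (π π' : Profile A) :
    ∀ g : GameTree A, g.visited B = ∅ → g.value π = g.value π'
  | terminal _, _ => rfl
  | chance _ _ next, h => by
      simp only [visited, Set.iUnion_eq_empty] at h
      exact Finset.sum_congr rfl fun c _ => by
        rw [value_eq_of_visited_eq_empty π π' (next c) (h c)]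
  | decision s next, h => absurd h (Set.insert_nonempty s _).ne_empty

theorem value_le {π : Profile A} (hπ : IsStrategy π) {M : ℝ} :
    ∀ g : GameTree A, (∀ x ∈ g.payoffs, x ≤ M) → g.value π ≤ M
  | terminal x, h => h x rfl
  | chance n p next, h => by
      have hc : ∀ c, (next c).value π ≤ M := fun c =>
        value_le hπ (next c) fun x hx => h x (Set.mem_iUnion_of_mem c hx)
      calc ∑ c, p.1 c * (next c).value π ≤ ∑ c, p.1 c * M :=
            Finset.sum_le_sum fun c _ => mul_le_mul_of_nonneg_left (hc c) (p.2.1 c)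
        _ = M := by rw [← Finset.sum_mul, p.2.2, one_mul]
  | decision s next, h => by
      have hc : ∀ a, (next a).value π ≤ M := fun a =>
        value_le hπ (next a) fun x hx => h x (Set.mem_iUnion_of_mem a hx)
      calc ∑ a, π s a * (next a).value π ≤ ∑ a, π s a * M :=
            Finset.sum_le_sum fun a _ => mul_le_mul_of_nonneg_left (hc a) ((hπ s).1 a)
        _ = M := by rw [← Finset.sum_mul, (hπ s).2, one_mul]

theorem le_value {π : Profile A} (hπ : IsStrategy π) {M : ℝ} :
    ∀ g : GameTree A, (∀ x ∈ g.payoffs, M ≤ x) → M ≤ g.value π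
  | terminal x, h => h x rfl
  | chance n p next, h => by
      have hc : ∀ c, M ≤ (next c).value π := fun c =>
        le_value hπ (next c) fun x hx => h x (Set.mem_iUnion_of_mem c hx)
      calc M = ∑ c, p.1 c * M := by rw [← Finset.sum_mul, p.2.2, one_mul]
        _ ≤ ∑ c, p.1 c * (next c).value π :=
            Finset.sum_le_sum fun c _ => mul_le_mul_of_nonneg_left (hc c) (p.2.1 c)
  | decision s next, h => by
      have hc : ∀ a, M ≤ (next a).value π := fun a =>
        le_value hπ (next a) fun x hx => h x (Set.mem_iUnion_of_mem a hx)
      calc M = ∑ a, π s a * M := by rw [← Finset.sum_mul, (hπ s).2, one_mul]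
        _ ≤ ∑ a, π s a * (next a).value π :=
            Finset.sum_le_sum fun a _ => mul_le_mul_of_nonneg_left (hc a) ((hπ s).1 a)

theorem value_sub_value_le {π π' : Profile A} (hπ : IsStrategy π) (hπ' : IsStrategy π')
    {g : GameTree A} {Δ : ℝ} (h : ∀ x ∈ g.payoffs, ∀ y ∈ g.payoffs, x - y ≤ Δ) :
    g.value π - g.value π' ≤ Δ := by
  have : g.value π - Δ ≤ g.value π' := le_value hπ' g fun y hy => by
    have := value_le hπ (M := y + Δ) g fun x hx => by linarith [h x hx y hy]
    linarith
  linarith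

/-- Realization equivalence of the average strategy, at a node where the players have the records
`hist`: weighted by the probability that player `j` plays along their own record, the payoff
against the average is the sum of the payoffs against the averaged profiles. Perfect recall
enters through `past s = hist j` at the nodes of `j`, which makes the weights in the definition of
the average those of the node. -/
theorem sum_mul_value_deviate_average (G : Game A) {strat : ℕ → Profile A} {τ : Finset ℕ}
    (hs : ∀ t ∈ τ, IsStrategy (strat t)) {i j : Fin 2} (hij : j ≠ i) (π' : Profile A) :
    ∀ (g : GameTree A) (hist : Fin 2 → List (Σ s, A s)), g.Recalls G.owner G.past hist →
      (∑ t ∈ τ, ((hist j).map fun e => strat t e.1 e.2).prod) *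
          g.value (G.deviate i π' (G.average strat τ)) =
        ∑ t ∈ τ, ((hist j).map fun e => strat t e.1 e.2).prod *
          g.value (G.deviate i π' (strat t))
  | terminal x, hist, _ => by simp only [value, Finset.sum_mul]
  | chance n p next, hist, h => by
      simp only [value, Finset.mul_sum]
      rw [Finset.sum_comm]
      refine Finset.sum_congr rfl fun c _ => ?_
      have ih := sum_mul_value_deviate_average G hs hij π' (next c) hist (h c)
      rw [mul_left_comm, ih, Finset.mul_sum]
      exact Finset.sum_congr rfl fun t _ => by ring
  | decision s next, hist, h => by
      obtain ⟨hpast, hnext⟩ := h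
      simp only [value, Finset.mul_sum]
      rw [Finset.sum_comm]
      by_cases hi : G.owner s = i
      · refine Finset.sum_congr rfl fun a _ => ?_
        have ih := sum_mul_value_deviate_average G hs hij π' (next a) _ (hnext a)
        rw [Function.update_of_ne (by rw [hi]; exact hij)] at ih
        have hd : ∀ π, G.deviate i π' π s a = π' s a := fun π => by simp [Game.deviate, hi]
        simp only [hd]
        rw [mul_left_comm, ih, Finset.mul_sum]
        exact Finset.sum_congr rfl fun t _ => by ring
      · have hj : G.owner s = j := by omega
        have hd : ∀ π, G.deviate i π' π s = π s := fun π => by simp [Game.deviate, hi]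
        simp only [hd]
        have hw : ∀ t, G.reach (strat t) s = ((hist j).map fun e => strat t e.1 e.2).prod :=
          fun t => by rw [Game.reach, hpast, hj]
        have hw0 : ∀ t ∈ τ, 0 ≤ G.reach (strat t) s := fun t ht =>
          List.prod_nonneg fun x hx => by
            obtain ⟨e, -, rfl⟩ := List.mem_map.1 hx
            exact (hs t ht e.1).1 e.2
        simp only [← hw]
        refine Finset.sum_congr rfl fun a _ => ?_
        by_cases h0 : ∑ t ∈ τ, G.reach (strat t) s = 0
        · rw [h0, zero_mul]
          -- all weights vanish, so the unweighted average used here does not matter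
          refine (Finset.sum_eq_zero fun t ht => ?_).symm
          rw [(Finset.sum_eq_zero_iff_of_nonneg hw0).1 h0 t ht, zero_mul]
        · have ih := sum_mul_value_deviate_average G hs hij π' (next a) _ (hnext a)
          rw [hj, Function.update_self] at ih
          simp only [List.map_cons, List.prod_cons, ← hw] at ih
          -- the denominator of the average cancels the weight of the node
          rw [← mul_assoc, Game.average, if_neg h0, mul_div_cancel₀ _ h0]
          simp only [mul_comm (G.reach _ s)]
          rw [ih]
          exact Finset.sum_congr rfl fun t _ => by ring

end GameTree

theorem PureProfile.isStrategy_toProfile [∀ s, Fintype (A s)] (σ : PureProfile A) :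
    IsStrategy σ.toProfile := fun s =>
  ⟨fun a => by unfold PureProfile.toProfile; split_ifs <;> norm_num,
    by classical simp [PureProfile.toProfile, Finset.sum_ite_eq']⟩

/-! ### Averages of profiles and Nash equilibria -/

namespace Game

theorem isStrategy_deviate [∀ s, Fintype (A s)] (G : Game A) (i : Fin 2) {π' π : Profile A}
    (hπ' : IsStrategy π') (hπ : IsStrategy π) : IsStrategy (G.deviate i π' π) := fun s => by
  unfold Game.deviate
  split_ifs
  exacts [hπ' s, hπ s]

theorem deviate_self (G : Game A) (i : Fin 2) (π : Profile A) : G.deviate i π π = π := by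
  funext s
  simp [Game.deviate]

section
variable [∀ s, Fintype (A s)]

theorem isStrategy_average (G : Game A) {strat : ℕ → Profile A} {τ : Finset ℕ}
    (hs : ∀ t ∈ τ, IsStrategy (strat t)) (hτ : τ.Nonempty) : IsStrategy (G.average strat τ) := by
  intro s
  have hw0 : ∀ t ∈ τ, 0 ≤ G.reach (strat t) s := fun t ht =>
    List.prod_nonneg fun x hx => by
      obtain ⟨e, -, rfl⟩ := List.mem_map.1 hx
      exact (hs t ht e.1).1 e.2
  have hcard : (τ.card : ℝ) ≠ 0 := by exact_mod_cast hτ.card_ne_zero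
  unfold average
  split_ifs with h0
  · refine ⟨fun a => div_nonneg (Finset.sum_nonneg fun t ht => (hs t ht s).1 a) (by positivity), ?_⟩
    rw [← Finset.sum_div, Finset.sum_comm, Finset.sum_congr rfl fun t ht => (hs t ht s).2]
    simp [hcard]
  · refine ⟨fun a => div_nonneg (Finset.sum_nonneg fun t ht =>
      mul_nonneg (hw0 t ht) ((hs t ht s).1 a)) (Finset.sum_nonneg hw0), ?_⟩
    rw [← Finset.sum_div, Finset.sum_comm]
    simp only [← Finset.mul_sum]
    rw [Finset.sum_congr rfl fun t ht => by rw [(hs t ht s).2, mul_one], div_self h0]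

/-- Playing against the average strategy of the opponent yields the average payoff. -/
theorem card_mul_value_deviate_average (G : Game A) {strat : ℕ → Profile A} {τ : Finset ℕ}
    (hs : ∀ t ∈ τ, IsStrategy (strat t)) (l i : Fin 2) (π' : Profile A) :
    (τ.card : ℝ) * G.value l (G.deviate i π' (G.average strat τ)) =
      ∑ t ∈ τ, G.value l (G.deviate i π' (strat t)) := by
  have h := GameTree.sum_mul_value_deviate_average G hs (i := i) (j := 1 - i) (by omega) π'
    G.root _ G.perfect_recall
  simp only [List.map_nil, List.prod_nil, one_mul, Finset.sum_const, nsmul_eq_mul, mul_one] at h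
  unfold value
  split_ifs
  · exact h
  · rw [mul_neg, h, Finset.sum_neg_distrib]

theorem value_sub_value_le (G : Game A) {Δ : ℝ}
    (h : ∀ x ∈ G.root.payoffs, ∀ y ∈ G.root.payoffs, x - y ≤ Δ) (i : Fin 2) {π π' : Profile A}
    (hπ : IsStrategy π) (hπ' : IsStrategy π') : G.value i π - G.value i π' ≤ Δ := by
  have h1 := GameTree.value_sub_value_le hπ hπ' h
  have h2 := GameTree.value_sub_value_le hπ' hπ h
  unfold value
  split_ifs <;> linarith

theorem value_one_sub (G : Game A) (i : Fin 2) (π : Profile A) :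
    G.value (1 - i) π = - G.value i π := by
  fin_cases i <;> simp [value]

/-- If the regrets of the two players sum to at most `ε` per round, then the average of the
profiles is an `ε`-Nash equilibrium. -/
theorem isNash_average (G : Game A) {strat : ℕ → Profile A} {τ : Finset ℕ}
    (hs : ∀ t ∈ τ, IsStrategy (strat t)) (hτ : τ.Nonempty) {ε R : ℝ}
    (hreg : ∀ i π, IsStrategy π →
      ∑ t ∈ τ, (G.value i (G.deviate i π (strat t)) - G.value i (strat t)) ≤ R)
    (hR : 2 * R ≤ ε * τ.card) : G.IsNash ε (G.average strat τ) := by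
  have hav := G.isStrategy_average hs hτ
  have hcard : (0 : ℝ) < τ.card := by exact_mod_cast hτ.card_pos
  have key : ∀ i π π'', IsStrategy π → IsStrategy π'' →
      G.value i (G.deviate i π (G.average strat τ)) -
        G.value i (G.deviate (1 - i) π'' (G.average strat τ)) ≤ ε := by
    intro i π π'' hπ hπ''
    -- in the sum of the regrets of the two players the payoffs of the iterates cancel
    have h1 := hreg i π hπ
    have h2 := hreg (1 - i) π'' hπ''
    rw [Finset.sum_sub_distrib] at h1 h2
    rw [← G.card_mul_value_deviate_average hs] at h1 h2
    simp only [value_one_sub, Finset.sum_neg_distrib] at h2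
    refine le_of_mul_le_mul_left ?_ hcard
    linarith
  refine ⟨hav, fun i π' hπ' => ⟨?_, ?_⟩⟩
  · have := key i π' _ hπ' hav
    rw [deviate_self] at this
    linarith
  · have := key i _ π' hav hπ'
    rw [deviate_self] at this
    linarith

theorem isNash_of_visited_eq_empty (G : Game A) {B : Population A} (h : G.root.visited B = ∅)
    {ε : ℝ} (hε : 0 < ε) {π : Profile A} (hπ : IsStrategy π) : G.IsNash ε π := by
  have hv : ∀ i π₁ π₂, G.value i π₁ = G.value i π₂ := fun i π₁ π₂ => by
    rw [value, value, GameTree.value_eq_of_visited_eq_empty π₁ π₂ G.root h]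
  refine ⟨hπ, fun i π' _ => ⟨?_, ?_⟩⟩
  · rw [hv i _ π]; linarith
  · rw [hv i (G.deviate (1 - i) π' π) π]; linarith

end

/-! ### Sizes of restricted games -/

theorem sizeOf_le_size (G : Game A) (i : Fin 2) (B : Population A) : G.sizeOf i B ≤ G.size B :=
  Finset.single_le_sum (f := fun i => G.sizeOf i B) (fun _ _ => Nat.zero_le _) (Finset.mem_univ i)

section
variable [Fintype S]

theorem sizeOf_mono (G : Game A) (i : Fin 2) {B B' : Population A} (h : ∀ s, B s ⊆ B' s) :
    G.sizeOf i B ≤ G.sizeOf i B' :=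
  Set.ncard_le_ncard (fun _ hs => ⟨GameTree.visited_mono h _ hs.1, hs.2⟩) (Set.toFinite _)

theorem size_mono (G : Game A) {B B' : Population A} (h : ∀ s, B s ⊆ B' s) :
    G.size B ≤ G.size B' :=
  Finset.sum_le_sum fun i _ => G.sizeOf_mono i h

theorem visited_eq_empty_of_size_eq_zero (G : Game A) {B : Population A} (h : G.size B = 0) :
    G.root.visited B = ∅ := by
  refine Set.eq_empty_iff_forall_notMem.2 fun s hs => ?_
  have h1 : G.sizeOf (G.owner s) B = 0 := Nat.le_zero.1 (h ▸ G.sizeOf_le_size _ B)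
  have h2 := (Set.ncard_eq_zero (Set.toFinite _)).1 h1
  exact (Set.eq_empty_iff_forall_notMem.1 h2 s) ⟨hs, rfl⟩

theorem size_eq_zero_of_size_eq_zero (G : Game A) {B : Population A} (B' : Population A)
    (h : G.size B = 0) : G.size B' = 0 := by
  simp [size, sizeOf, GameTree.visited_eq_empty B' _ (G.visited_eq_empty_of_size_eq_zero h)]

end

end Game

/-! ### Logarithmic factors -/

theorem polylog_nonneg (p : ℕ) {x : ℝ} (hx : 0 ≤ x) : 0 ≤ polylog p x :=
  pow_nonneg (Real.log_nonneg (by linarith [Real.add_one_le_exp (1 : ℝ)])) p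

theorem polylog_mono (p : ℕ) {x y : ℝ} (hx : 0 ≤ x) (hxy : x ≤ y) :
    polylog p x ≤ polylog p y := by
  have := Real.exp_pos 1
  exact pow_le_pow_left₀ (Real.log_nonneg (by linarith [Real.add_one_le_exp (1 : ℝ)]))
    (Real.log_le_log (by linarith) (by linarith)) p

theorem one_le_polylog (p : ℕ) {x : ℝ} (hx : 0 ≤ x) : 1 ≤ polylog p x := by
  have := Real.exp_pos 1
  refine one_le_pow₀ ?_
  rw [Real.le_log_iff_exp_le (by linarith)]
  linarith

/-- Every power of an affine function of `log (e + u)` is eventually below any linear function. -/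
theorem exists_forall_pow_log_le (K c : ℝ) (hK : 0 ≤ K) (hc : 0 < c) (p : ℕ) :
    ∃ u₀ : ℝ, 1 ≤ u₀ ∧ ∀ u, u₀ ≤ u → c * (K + 2 * Real.log (Real.exp 1 + u)) ^ p ≤ u := by
  have h1 := (Real.isLittleO_pow_log_id_atTop (n := p)).bound
    (show (0 : ℝ) < 1 / (c * 5 ^ p) by positivity)
  have h2 : ∀ᶠ u : ℝ in Filter.atTop, K ≤ Real.log u :=
    Real.tendsto_log_atTop.eventually_ge_atTop K
  obtain ⟨u₀, hu₀⟩ := Filter.eventually_atTop.1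
    ((h1.and h2).and (Filter.eventually_ge_atTop (2 * Real.exp 1)))
  refine ⟨max 1 u₀, le_max_left _ _, fun u hu => ?_⟩
  obtain ⟨⟨h1, h2⟩, h3⟩ := hu₀ u (le_trans (le_max_right _ _) hu)
  have he : 2 ≤ Real.exp 1 := by linarith [Real.add_one_le_exp (1 : ℝ)]
  have hu0 : 0 < u := by linarith
  have hlog0 : 0 ≤ Real.log u := hK.trans h2
  have hlog : Real.log (Real.exp 1 + u) ≤ 2 * Real.log u := by
    rw [show (2 : ℝ) * Real.log u = Real.log (u ^ 2) by simp]
    exact Real.log_le_log (by linarith) (by nlinarith)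
  have hpos : 0 ≤ Real.log (Real.exp 1 + u) := Real.log_nonneg (by linarith)
  rw [id, Real.norm_of_nonneg hu0.le, Real.norm_of_nonneg (pow_nonneg hlog0 p),
    one_div, ← div_eq_inv_mul, le_div_iff₀ (by positivity)] at h1
  calc c * (K + 2 * Real.log (Real.exp 1 + u)) ^ p
      ≤ c * (5 * Real.log u) ^ p := by gcongr; linarith
    _ = Real.log u ^ p * (c * 5 ^ p) := by rw [mul_pow]; ring
    _ ≤ u := h1

/-- Multiplying the argument of the logarithm by powers of `e + y` costs only a factor
`log (e + y) ≥ 1`, which is what the polylogarithmic factor in the bound on the rounds absorbs. -/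
theorem log_mul_pow_mul_pow_le {Δ y u : ℝ} (hΔ : 0 ≤ Δ) (hy : 0 ≤ y) (hu : 0 ≤ u) (p : ℕ) :
    Real.log ((Real.exp 1 + Δ) * ((Real.exp 1 + y) ^ (3 + 2 * p)) * (Real.exp 1 + u) ^ 2) ≤
      Real.log (Real.exp 1 + y) *
        (Real.log (Real.exp 1 + Δ) + 3 + 2 * p + 2 * Real.log (Real.exp 1 + u)) := by
  have he : 2 ≤ Real.exp 1 := by linarith [Real.add_one_le_exp (1 : ℝ)]
  have hL : 1 ≤ Real.log (Real.exp 1 + y) := by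
    rw [Real.le_log_iff_exp_le (by linarith)]
    linarith
  have h1 := le_mul_of_one_le_left
    (Real.log_nonneg (show 1 ≤ Real.exp 1 + Δ by linarith)) hL
  have h2 := le_mul_of_one_le_left
    (Real.log_nonneg (show 1 ≤ Real.exp 1 + u by linarith)) hL
  rw [Real.log_mul (by positivity) (by positivity),
    Real.log_mul (by positivity) (by positivity), Real.log_pow, Real.log_pow]
  push_cast
  linarith

/-- The number of rounds after which a regret of `k Δ + c k X √T polylog (X k T)` per player is
at most `ε / 2` per round, where `k` stands for the number of windows and `X` for the size of the
restricted game. -/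
theorem exists_rounds_bound (c Δ : ℝ) (hc : 0 < c) (hΔ : 0 < Δ) (p : ℕ) :
    ∃ (C : ℝ) (q : ℕ), 0 < C ∧ ∀ k X T ε : ℝ, 1 ≤ k → 1 ≤ X → 0 < ε → ε ≤ Δ →
      C * (k ^ 2 * X ^ 2 / ε ^ 2) * polylog q (k * X / ε) ≤ T →
        2 * (k * Δ + c * k * X * √T * polylog p (X * k * T)) ≤ ε * T := by
  set K : ℝ := Real.log (Real.exp 1 + Δ) + 3 + 2 * p with hK
  have he : 2 ≤ Real.exp 1 := by linarith [Real.add_one_le_exp (1 : ℝ)]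
  have hK0 : 0 ≤ K := by
    have := Real.log_nonneg (show 1 ≤ Real.exp 1 + Δ by linarith)
    positivity
  obtain ⟨u₀, hu₀, hu⟩ := exists_forall_pow_log_le K (4 * c) hK0 (by positivity) p
  refine ⟨u₀ ^ 2 + 4 * Δ ^ 2, 2 * p, by positivity, fun k X T ε hk hX hε hεΔ hT => ?_⟩
  set y : ℝ := k * X / ε with hy
  have hkX : k * X = ε * y := by rw [hy]; field_simp
  have hy0 : 0 < y := by positivity
  have hyΔ : 1 ≤ Δ * y := by
    have h1 : 1 ≤ k * X := by nlinarith
    have h2 : ε * y ≤ Δ * y := by gcongr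
    linarith
  set L : ℝ := Real.log (Real.exp 1 + y) with hL
  have hL1 : 1 ≤ L := by
    rw [hL, Real.le_log_iff_exp_le (by linarith)]
    linarith
  have hLy : L ≤ Real.exp 1 + y := (Real.log_le_self (by linarith))
  have hT' : (u₀ ^ 2 + 4 * Δ ^ 2) * (y ^ 2 * L ^ (2 * p)) ≤ T := by
    refine le_trans (le_of_eq ?_) hT
    rw [polylog, ← hL, hy]
    ring
  have hLp : 1 ≤ L ^ p := one_le_pow₀ hL1
  have hL2p : L ^ (2 * p) = (L ^ p) ^ 2 := by rw [mul_comm, pow_mul]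
  have hd : 0 < y * L ^ p := by positivity
  have hT0 : 0 < T := lt_of_lt_of_le (by positivity) hT'
  have hTΔ : 4 * Δ ^ 2 * y ^ 2 ≤ T := by
    refine le_trans ?_ hT'
    have : 1 ≤ L ^ (2 * p) := one_le_pow₀ hL1
    calc 4 * Δ ^ 2 * y ^ 2 = (0 + 4 * Δ ^ 2) * (y ^ 2 * 1) := by ring
      _ ≤ (u₀ ^ 2 + 4 * Δ ^ 2) * (y ^ 2 * L ^ (2 * p)) := by gcongr; positivity
  -- the cost `k Δ` of the last iterations of the windows
  have hfirst : 4 * (k * Δ) ≤ ε * T := by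
    have h1 : k ≤ ε * y := by rw [← hkX]; nlinarith
    calc 4 * (k * Δ) ≤ 4 * (ε * y * Δ) := by gcongr
      _ = ε * (4 * (Δ * y * 1)) := by ring
      _ ≤ ε * (4 * (Δ * y * (Δ * y))) := by gcongr
      _ = ε * (4 * Δ ^ 2 * y ^ 2) := by ring
      _ ≤ ε * T := by gcongr
  -- write `√T = y L ^ p u`; then `log (e + X k T)` is at most `L (K + 2 log (e + u))`
  set u : ℝ := √T / (y * L ^ p) with hudef
  have hsq : √T = y * L ^ p * u := by rw [hudef]; field_simp
  have hTu : T = (y * L ^ p * u) ^ 2 := by rw [← hsq, Real.sq_sqrt hT0.le]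
  have huu : u₀ ≤ u := by
    rw [hudef, le_div_iff₀ hd]
    refine Real.le_sqrt_of_sq_le (le_trans ?_ hT')
    rw [hL2p]
    have : 0 ≤ 4 * Δ ^ 2 * (y ^ 2 * (L ^ p) ^ 2) := by positivity
    linarith [mul_pow u₀ (y * L ^ p) 2, mul_pow y (L ^ p) 2,
      add_mul (u₀ ^ 2) (4 * Δ ^ 2) (y ^ 2 * (L ^ p) ^ 2),
      congrArg (u₀ ^ 2 * ·) (mul_pow y (L ^ p) 2)]
  have hu1 : 1 ≤ u := hu₀.trans huu
  have hlogu : 0 ≤ Real.log (Real.exp 1 + u) := Real.log_nonneg (by linarith)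
  have hM : Real.log (Real.exp 1 + X * k * T) ≤ L * (K + 2 * Real.log (Real.exp 1 + u)) := by
    refine le_trans (Real.log_le_log (by positivity) ?_)
      (log_mul_pow_mul_pow_le hΔ.le hy0.le (by linarith) p)
    have hXkT : X * k * T = ε * (y ^ 3 * L ^ (2 * p) * u ^ 2) := by
      rw [mul_comm X k, hkX, hTu, hL2p]; ring
    rw [hXkT, mul_assoc (Real.exp 1 + Δ), add_mul]
    refine add_le_add (le_mul_of_one_le_right (by positivity) ?_) ?_
    · exact one_le_mul_of_one_le_of_one_le (one_le_pow₀ (by linarith)) (one_le_pow₀ (by linarith))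
    · rw [pow_add]
      gcongr <;> linarith
  have hM0 : 0 ≤ Real.log (Real.exp 1 + X * k * T) :=
    Real.log_nonneg (by have : 0 ≤ X * k * T := by positivity
                        linarith)
  have hsecond : 4 * (c * k * X * √T * polylog p (X * k * T)) ≤ ε * T := by
    calc 4 * (c * k * X * √T * polylog p (X * k * T))
        = ε * √T * y * (4 * c * Real.log (Real.exp 1 + X * k * T) ^ p) := by
          rw [polylog, mul_assoc c, hkX]; ring
      _ ≤ ε * √T * y * (4 * c * (L * (K + 2 * Real.log (Real.exp 1 + u))) ^ p) := by gcongr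
      _ = ε * √T * y * L ^ p * (4 * c * (K + 2 * Real.log (Real.exp 1 + u)) ^ p) := by
          rw [mul_pow]; ring
      _ ≤ ε * √T * y * L ^ p * u := by gcongr; exact hu u huu
      _ = ε * (√T * √T) := by nth_rewrite 3 [hsq]; ring
      _ = ε * T := by rw [Real.mul_self_sqrt hT0.le]
  linarith

/-! ### Executions of the algorithm -/

namespace Run

theorem window_succ_of_win_eq {r : Run A} {t : ℕ} (h : r.win (t + 1) = r.win t) :
    r.window (t + 1) = insert (t + 1) (r.window t) := by
  rw [window, window, ← Finset.insert_Icc_right_eq_Icc_add_one (by omega), Finset.filter_insert,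
    if_pos rfl, h]

theorem window_of_forall_win_lt {r : Run A} {t : ℕ} (ht : 1 ≤ t) (h : ∀ t', 1 ≤ t' → t' < t →
    r.win t' < r.win t) : r.window t = {t} := by
  ext t'
  simp only [window, Finset.mem_filter, Finset.mem_Icc, Finset.mem_singleton]
  constructor
  · rintro ⟨⟨h1, h2⟩, h3⟩
    by_contra hne
    exact (h t' h1 (by omega)).ne h3
  · rintro rfl
    exact ⟨⟨ht, le_rfl⟩, rfl⟩

theorem card_window_succ_of_win_eq {r : Run A} {t : ℕ} (h : r.win (t + 1) = r.win t) :
    (r.window (t + 1)).card = (r.window t).card + 1 := by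
  rw [window_succ_of_win_eq h, Finset.card_insert_of_notMem]
  simp [window]

theorem window_one (r : Run A) : r.window 1 = {1} :=
  window_of_forall_win_lt le_rfl fun _ _ _ => by omega

variable [∀ s, Fintype (A s)] {G : Game A} {rm : Population A → ℕ → Profile A} {r : Run A}

theorem isXODO_iff_isRMDO_one : r.IsXODO G rm ↔ r.IsRMDO G rm (fun _ => 1) := by
  constructor
  · rintro ⟨h1, h2⟩
    exact ⟨h1, fun t ht => (h2 t ht).1, fun t ht _ => (h2 t ht).2,
      fun t _ h => absurd (by simp [Nat.mod_one]) h⟩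
  · rintro ⟨h1, h2, h3, -⟩
    exact ⟨h1, fun t ht => ⟨h2 t ht, h3 t ht (by simp [Nat.mod_one])⟩⟩

/-! ### Populations and windows of an execution -/

namespace IsXODO

variable (hr : r.IsXODO G rm)
include hr

theorem pop_subset_succ {t : ℕ} (ht : 1 ≤ t) (s : S) : r.pop t s ⊆ r.pop (t + 1) s := by
  rw [(hr.step t ht).2.pop_succ]
  exact Set.subset_union_left

theorem pop_mono {t t' : ℕ} (ht : 1 ≤ t) (h : t ≤ t') (s : S) : r.pop t s ⊆ r.pop t' s := by
  induction t', h using Nat.le_induction with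
  | base => exact subset_rfl
  | succ n hn ih => exact ih.trans (hr.pop_subset_succ (ht.trans hn) s)

theorem pop_nonempty {t : ℕ} (ht : 1 ≤ t) (s : S) : (r.pop t s).Nonempty := by
  refine Set.Nonempty.mono (hr.pop_mono le_rfl ht s) ?_
  rw [hr.init.pop_one]
  exact Set.singleton_nonempty _

theorem win_le_win_succ {t : ℕ} (ht : 1 ≤ t) : r.win t ≤ r.win (t + 1) := by
  by_cases h : r.pop (t + 1) = r.pop t
  · exact ((hr.step t ht).2.win_same h).ge
  · rw [(hr.step t ht).2.win_new h]; exact Nat.le_succ _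

theorem win_succ_le {t : ℕ} (ht : 1 ≤ t) : r.win (t + 1) ≤ r.win t + 1 := by
  by_cases h : r.pop (t + 1) = r.pop t
  · rw [(hr.step t ht).2.win_same h]; exact Nat.le_succ _
  · exact ((hr.step t ht).2.win_new h).le

theorem pop_succ_eq_of_win_eq {t : ℕ} (ht : 1 ≤ t) (h : r.win (t + 1) = r.win t) :
    r.pop (t + 1) = r.pop t := by
  by_contra hne
  have := (hr.step t ht).2.win_new hne
  omega

theorem win_mono {t t' : ℕ} (ht : 1 ≤ t) (h : t ≤ t') : r.win t ≤ r.win t' := by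
  induction t', h using Nat.le_induction with
  | base => exact le_rfl
  | succ n hn ih => exact ih.trans (hr.win_le_win_succ (ht.trans hn))

theorem image_win {T : ℕ} (hT : 1 ≤ T) :
    (Finset.Icc 1 T).image r.win = Finset.range (r.win T + 1) := by
  induction T, hT using Nat.le_induction with
  | base => simp [hr.init.win_one]
  | succ n hn ih =>
    rw [← Finset.insert_Icc_right_eq_Icc_add_one (by omega), Finset.image_insert, ih]
    have h1 := hr.win_le_win_succ hn
    have h2 := hr.win_succ_le hn
    ext j
    simp only [Finset.mem_insert, Finset.mem_range]
    omega

theorem numWindows_eq {T : ℕ} (hT : 1 ≤ T) : r.numWindows T = r.win T + 1 := by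
  rw [numWindows, hr.image_win hT, Finset.card_range]

theorem one_le_numWindows {T : ℕ} (hT : 1 ≤ T) : 1 ≤ r.numWindows T := by
  rw [hr.numWindows_eq hT]
  exact Nat.le_add_left _ _

theorem numWindows_mono {t T : ℕ} (ht : 1 ≤ t) (h : t ≤ T) :
    r.numWindows t ≤ r.numWindows T := by
  rw [hr.numWindows_eq ht, hr.numWindows_eq (ht.trans h)]
  exact Nat.succ_le_succ (hr.win_mono ht h)

/-- Every window adds at most one action at each information set. -/
theorem ncard_pop_le {t : ℕ} (ht : 1 ≤ t) (s : S) : (r.pop t s).ncard ≤ r.win t + 1 := by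
  induction t, ht using Nat.le_induction with
  | base => rw [hr.init.pop_one, Set.ncard_singleton]; exact Nat.le_add_left _ _
  | succ n hn ih =>
    by_cases h : r.pop (n + 1) = r.pop n
    · rw [h, (hr.step n hn).2.win_same h]; exact ih
    · rw [(hr.step n hn).2.win_new h, (hr.step n hn).2.pop_succ, Set.union_singleton]
      exact (Set.ncard_insert_le _ _).trans (Nat.succ_le_succ ih)

theorem maxActions_le [Fintype S] {t : ℕ} (ht : 1 ≤ t) :
    G.maxActions (r.pop t) ≤ r.win t + 1 :=
  Finset.sup_le fun s _ => hr.ncard_pop_le ht s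

theorem window_succ_of_win_ne {t : ℕ} (ht : 1 ≤ t) (h : r.win (t + 1) ≠ r.win t) :
    r.window (t + 1) = {t + 1} :=
  window_of_forall_win_lt (by omega) fun t' h1 h2 => by
    have := hr.win_mono h1 (Nat.le_of_lt_succ h2)
    have := hr.win_le_win_succ ht
    omega

/-- The profiles of a window are the successive iterates of the minimizer in one restricted
game. -/
theorem sum_window {M : Type*} [AddCommMonoid M] (f : Profile A → M) {t : ℕ} (ht : 1 ≤ t) :
    ∑ t' ∈ r.window t, f (r.strat t') =
      ∑ n ∈ Finset.range (r.window t).card, f (rm (r.pop t) n) := by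
  induction t, ht using Nat.le_induction with
  | base =>
    have := (hr.step 1 le_rfl).1
    simp only [Minimizes, window_one, Finset.card_singleton] at this
    simp [window_one, this]
  | succ n hn ih =>
    have hm := (hr.step (n + 1) (by omega)).1
    by_cases h : r.win (n + 1) = r.win n
    · rw [Minimizes, card_window_succ_of_win_eq h, Nat.add_sub_cancel] at hm
      rw [card_window_succ_of_win_eq h, Finset.sum_range_succ, ← hm, hr.pop_succ_eq_of_win_eq hn h,
        ← ih, window_succ_of_win_eq h, Finset.sum_insert (by simp [window]), add_comm]
    · rw [Minimizes, hr.window_succ_of_win_ne hn h] at hm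
      simp only [Finset.card_singleton, Nat.sub_self] at hm
      simp [hr.window_succ_of_win_ne hn h, hm]

/-! ### The regret of an execution -/

variable [Fintype S] {c : ℝ} {p : ℕ}

theorem isStrategy_strat (hrm : IsRegretMinimizer G c p rm) {t : ℕ} (ht : 1 ≤ t) :
    IsStrategy (r.strat t) := by
  rw [(hr.step t ht).1]
  exact (hrm.isStrategyIn _ (hr.pop_nonempty ht) _).1

/-- If the window continues after iteration `t`, the regret in the window up to `t`, against all
strategies of the original game, is at most the regret within the restricted game: a best response
to the window average belongs to the restricted game. -/
theorem regret_window_le_of_win_succ_eq (hrm : IsRegretMinimizer G c p rm) {t : ℕ} (ht : 1 ≤ t)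
    (h : r.win (t + 1) = r.win t) (i : Fin 2) {π : Profile A} (hπ : IsStrategy π) :
    ∑ t' ∈ r.window t, (G.value i (G.deviate i π (r.strat t')) - G.value i (r.strat t')) ≤
      c * G.sizeOf i (r.pop t) * √(G.maxActions (r.pop t) * (r.window t).card) *
        polylog p (G.sizeOf i (r.pop t) * G.maxActions (r.pop t) * (r.window t).card) := by
  have hs : ∀ t' ∈ r.window t, IsStrategy (r.strat t') := fun t' ht' =>
    hr.isStrategy_strat hrm (Finset.mem_Icc.1 (Finset.mem_filter.1 ht').1).1
  have hex := (hr.step t ht).2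
  have hbr : IsStrategyIn (r.pop t) (r.br t).toProfile := by
    refine ⟨PureProfile.isStrategy_toProfile _, fun s a ha => if_neg ?_⟩
    rintro rfl
    refine ha ?_
    rw [← hr.pop_succ_eq_of_win_eq ht h, hex.pop_succ]
    exact Or.inr rfl
  refine le_trans ?_ (hrm.regret_le (r.pop t) (hr.pop_nonempty ht) i (r.window t).card _ hbr)
  rw [← hr.sum_window (fun σ => G.value i (G.deviate i (r.br t).toProfile σ) - G.value i σ) ht,
    Finset.sum_sub_distrib, Finset.sum_sub_distrib, ← G.card_mul_value_deviate_average hs,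
    ← G.card_mul_value_deviate_average hs]
  exact sub_le_sub_right
    (mul_le_mul_of_nonneg_left (hex.isBestResponse i π hπ) (Nat.cast_nonneg _)) _

/-- The regret in a window against all strategies of the original game. The last iteration of the
window is bounded trivially, by `Δ`. -/
theorem regret_window_le (hrm : IsRegretMinimizer G c p rm) (hc : 0 ≤ c) {Δ : ℝ}
    (hΔ : ∀ x ∈ G.root.payoffs, ∀ y ∈ G.root.payoffs, x - y ≤ Δ) {t T : ℕ} (ht : 1 ≤ t)
    (htT : t ≤ T) (i : Fin 2) {π : Profile A} (hπ : IsStrategy π) :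
    ∑ t' ∈ r.window t, (G.value i (G.deviate i π (r.strat t')) - G.value i (r.strat t')) ≤
      Δ + c * G.size (r.pop T) * √(r.numWindows T * (r.window t).card) *
        polylog p (G.size (r.pop T) * r.numWindows T * T) := by
  have hlast : G.value i (G.deviate i π (r.strat t)) - G.value i (r.strat t) ≤ Δ :=
    have hst := hr.isStrategy_strat hrm ht
    G.value_sub_value_le hΔ i (Game.isStrategy_deviate G i hπ hst) hst
  have hpl := polylog_nonneg p (x := G.size (r.pop T) * r.numWindows T * T) (by positivity)
  by_cases h : ∃ n, 1 ≤ n ∧ t = n + 1 ∧ r.win (n + 1) = r.win n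
  · obtain ⟨n, hn, rfl, h⟩ := h
    rw [window_succ_of_win_eq h, Finset.sum_insert (by simp [window])]
    refine add_le_add hlast ((hr.regret_window_le_of_win_succ_eq hrm hn h i hπ).trans ?_)
    rw [← window_succ_of_win_eq h, card_window_succ_of_win_eq h]
    have h1 : G.sizeOf i (r.pop n) ≤ G.size (r.pop T) :=
      (G.sizeOf_le_size i _).trans (G.size_mono (hr.pop_mono hn (by omega)))
    have h2 : G.maxActions (r.pop n) ≤ r.numWindows T :=
      (hr.maxActions_le hn).trans ((hr.numWindows_eq hn).ge.trans
        (hr.numWindows_mono hn (by omega)))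
    have h3 : (r.window n).card ≤ T := by
      refine (Finset.card_filter_le _ _).trans ?_
      rw [Nat.card_Icc]
      omega
    gcongr
    · exact polylog_nonneg p (by positivity)
    · omega
    · exact polylog_mono p (by positivity) (by gcongr)
  -- otherwise the iteration is the first of its window
  · have hw : r.window t = {t} := by
      obtain rfl | ht1 := ht.eq_or_lt
      · exact window_one r
      · obtain ⟨n, rfl⟩ := Nat.exists_eq_add_of_le' ht
        exact hr.window_succ_of_win_ne (by omega) fun h' => h ⟨n, by omega, rfl, h'⟩
    rw [hw, Finset.sum_singleton]
    have : 0 ≤ c * G.size (r.pop T) * √(r.numWindows T * (({t} : Finset ℕ).card)) *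
        polylog p (G.size (r.pop T) * r.numWindows T * T) := by positivity
    linarith

/-- The regret of a player in the first `T` iterations against all strategies of the original
game: the bounds for the windows are summed with the Cauchy-Schwarz inequality. -/
theorem regret_le (hrm : IsRegretMinimizer G c p rm) (hc : 0 ≤ c) {Δ : ℝ}
    (hΔ : ∀ x ∈ G.root.payoffs, ∀ y ∈ G.root.payoffs, x - y ≤ Δ) {T : ℕ} (hT : 1 ≤ T)
    (i : Fin 2) {π : Profile A} (hπ : IsStrategy π) :
    ∑ t ∈ Finset.Icc 1 T, (G.value i (G.deviate i π (r.strat t)) - G.value i (r.strat t)) ≤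
      r.numWindows T * Δ + c * r.numWindows T * G.size (r.pop T) * √T *
        polylog p (G.size (r.pop T) * r.numWindows T * T) := by
  set J := (Finset.Icc 1 T).image r.win with hJ
  set F : ℕ → Finset ℕ := fun j => (Finset.Icc 1 T).filter fun t => r.win t = j with hF
  set P := polylog p (G.size (r.pop T) * r.numWindows T * T) with hP
  have hP0 : 0 ≤ P := polylog_nonneg p (by positivity)
  have hmaps : ∀ t ∈ Finset.Icc 1 T, r.win t ∈ J := fun t ht => Finset.mem_image_of_mem _ ht
  have hk : J.card = r.numWindows T := rfl
  have hcard : ∑ j ∈ J, ((F j).card : ℝ) = T := by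
    have := Finset.card_eq_sum_card_fiberwise hmaps
    rw [Nat.card_Icc, Nat.add_sub_cancel] at this
    exact_mod_cast this.symm
  have hfib : ∀ j ∈ J, ∑ t ∈ F j, (G.value i (G.deviate i π (r.strat t)) - G.value i (r.strat t)) ≤
      Δ + c * G.size (r.pop T) * √(r.numWindows T * (F j).card) * P := by
    intro j hj
    have hne : (F j).Nonempty := by
      obtain ⟨t, ht, rfl⟩ := Finset.mem_image.1 hj
      exact ⟨t, Finset.mem_filter.2 ⟨ht, rfl⟩⟩
    have hmem := Finset.mem_filter.1 ((F j).max'_mem hne)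
    have hmax := Finset.mem_Icc.1 hmem.1
    -- the iterations of window `j` among the first `T` are the window of the last of them
    have hFw : F j = r.window ((F j).max' hne) := by
      ext t
      constructor
      · intro ht
        have ht' := Finset.mem_filter.1 ht
        exact Finset.mem_filter.2 ⟨Finset.mem_Icc.2 ⟨(Finset.mem_Icc.1 ht'.1).1,
          (F j).le_max' t ht⟩, ht'.2.trans hmem.2.symm⟩
      · intro ht
        have ht' := Finset.mem_filter.1 ht
        have h1 := Finset.mem_Icc.1 ht'.1
        exact Finset.mem_filter.2 ⟨Finset.mem_Icc.2 ⟨h1.1, h1.2.trans hmax.2⟩,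
          ht'.2.trans hmem.2⟩
    rw [hFw]
    exact hr.regret_window_le hrm hc hΔ hmax.1 hmax.2 i hπ
  have hsqrt : ∑ j ∈ J, √((F j).card : ℝ) ≤ √(r.numWindows T) * √T := by
    rw [← Real.sqrt_mul (Nat.cast_nonneg _)]
    refine Real.le_sqrt_of_sq_le (sq_sum_le_card_mul_sum_sq.trans (le_of_eq ?_))
    simp only [Real.sq_sqrt (Nat.cast_nonneg _), hcard, hk]
  calc ∑ t ∈ Finset.Icc 1 T, (G.value i (G.deviate i π (r.strat t)) - G.value i (r.strat t))
      = ∑ j ∈ J, ∑ t ∈ F j, (G.value i (G.deviate i π (r.strat t)) - G.value i (r.strat t)) :=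
        (Finset.sum_fiberwise_of_maps_to hmaps _).symm
    _ ≤ ∑ j ∈ J, (Δ + c * G.size (r.pop T) * √(r.numWindows T * (F j).card) * P) :=
        Finset.sum_le_sum hfib
    _ = r.numWindows T * Δ +
          c * G.size (r.pop T) * √(r.numWindows T) * P * ∑ j ∈ J, √((F j).card : ℝ) := by
        rw [Finset.sum_add_distrib, Finset.sum_const, hk, nsmul_eq_mul, Finset.mul_sum]
        congr 1
        refine Finset.sum_congr rfl fun j _ => ?_
        rw [Real.sqrt_mul (Nat.cast_nonneg _)]
        ring
    _ ≤ r.numWindows T * Δ +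
          c * G.size (r.pop T) * √(r.numWindows T) * P * (√(r.numWindows T) * √T) := by
        gcongr
    _ = r.numWindows T * Δ +
          c * (√(r.numWindows T) * √(r.numWindows T)) * G.size (r.pop T) * √T * P := by ring
    _ = _ := by rw [Real.mul_self_sqrt (Nat.cast_nonneg _)]

end IsXODO

end Run

/-! ### Numbers of windows and of samples -/

namespace Run

theorem samples_one (r : Run A) (G : Game A) (T : ℕ) :
    r.samples G (fun _ => 1) T = ∑ t ∈ Finset.Icc 1 T, 2 * G.size (r.pop t) :=
  Finset.sum_congr rfl fun t _ => by simp [Nat.mod_one, two_mul]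

namespace IsXODO

variable [∀ s, Fintype (A s)] {G : Game A} {rm : Population A → ℕ → Profile A} {r : Run A}
  (hr : r.IsXODO G rm) [Fintype S]
include hr

/-- Every new window has an additional action in the population, so that there are finitely many
windows. -/
theorem win_le_sum_ncard {t : ℕ} (ht : 1 ≤ t) : r.win t ≤ ∑ s, (r.pop t s).ncard := by
  induction t, ht using Nat.le_induction with
  | base => simp [hr.init.win_one]
  | succ n hn ih =>
    by_cases h : r.pop (n + 1) = r.pop n
    · rw [h, (hr.step n hn).2.win_same h]; exact ih
    · rw [(hr.step n hn).2.win_new h]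
      refine Nat.succ_le_of_lt (ih.trans_lt ?_)
      obtain ⟨s, hs⟩ := Function.ne_iff.1 h
      exact Finset.sum_lt_sum
        (fun s _ => Set.ncard_le_ncard (hr.pop_subset_succ hn s) (Set.toFinite _))
        ⟨s, Finset.mem_univ s, Set.ncard_lt_ncard
          ((hr.pop_subset_succ hn s).ssubset_of_ne (Ne.symm hs)) (Set.toFinite _)⟩

theorem numWindows_le {t : ℕ} (ht : 1 ≤ t) :
    r.numWindows t ≤ ∑ s, Fintype.card (A s) + 1 := by
  rw [hr.numWindows_eq ht]
  refine Nat.succ_le_succ ((hr.win_le_sum_ncard ht).trans (Finset.sum_le_sum fun s _ => ?_))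
  rw [← Nat.card_eq_fintype_card]
  exact Set.ncard_le_card _

theorem samples_le (T : ℕ) : r.samples G (fun _ => 1) T ≤ 2 * T * G.size (r.pop T) := by
  rw [samples_one]
  calc ∑ t ∈ Finset.Icc 1 T, 2 * G.size (r.pop t)
      ≤ ∑ t ∈ Finset.Icc 1 T, 2 * G.size (r.pop T) := by
        refine Finset.sum_le_sum fun t ht => ?_
        obtain ⟨h1, h2⟩ := Finset.mem_Icc.1 ht
        exact Nat.mul_le_mul_left _ (G.size_mono (hr.pop_mono h1 h2))
    _ = 2 * T * G.size (r.pop T) := by simp; ring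

theorem mul_size_le_samples (T : ℕ) : 2 * T * G.size (r.pop 1) ≤ r.samples G (fun _ => 1) T := by
  rw [samples_one]
  calc 2 * T * G.size (r.pop 1) = ∑ t ∈ Finset.Icc 1 T, 2 * G.size (r.pop 1) := by simp; ring
    _ ≤ ∑ t ∈ Finset.Icc 1 T, 2 * G.size (r.pop t) :=
        Finset.sum_le_sum fun t ht =>
          Nat.mul_le_mul_left _ (G.size_mono (hr.pop_mono le_rfl (Finset.mem_Icc.1 ht).1))

end IsXODO

end Run

/-! ### Sample complexity -/

/-- The bound on the number of samples, for `k` windows and a restricted game of size `X`. -/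
noncomputable def sampleBound (C : ℝ) (q : ℕ) (ε k X : ℝ) : ℝ :=
  C * (2 * k ^ 2 * X ^ 3 / ε ^ 2) * polylog q (k * X / ε)

theorem sampleBound_mono {C ε k k' X X' : ℝ} (q : ℕ) (hC : 0 ≤ C) (hε : 0 < ε) (hk : 0 ≤ k)
    (hX : 0 ≤ X) (hkk' : k ≤ k') (hXX' : X ≤ X') :
    sampleBound C q ε k X ≤ sampleBound C q ε k' X' := by
  have hk' := hk.trans hkk'
  have hX' := hX.trans hXX'
  unfold sampleBound
  gcongr
  · exact polylog_nonneg q (by positivity)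
  · exact polylog_mono q (by positivity) (by gcongr)

theorem sampleBound_add (C C' : ℝ) (q : ℕ) (ε k X : ℝ) :
    sampleBound (C + C') q ε k X = sampleBound C q ε k X + sampleBound C' q ε k X := by
  simp only [sampleBound, add_mul]

theorem sampleBound_nonneg {C ε k X : ℝ} (q : ℕ) (hC : 0 ≤ C) (hε : 0 < ε) (hk : 0 ≤ k)
    (hX : 0 ≤ X) : 0 ≤ sampleBound C q ε k X :=
  mul_nonneg (by positivity) (polylog_nonneg q (by positivity))

theorem two_mul_le_sampleBound {Δ ε k X : ℝ} (q : ℕ) (hε : 0 < ε) (hεΔ : ε ≤ Δ) (hk : 1 ≤ k)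
    (hX : 1 ≤ X) : 2 * X ≤ sampleBound (Δ ^ 2) q ε k X := by
  calc 2 * X = ε ^ 2 * (2 * 1 ^ 2 * X ^ 1 / ε ^ 2) * 1 := by field_simp
    _ ≤ Δ ^ 2 * (2 * k ^ 2 * X ^ 3 / ε ^ 2) * polylog q (k * X / ε) := by
        gcongr
        · norm_num
        · exact one_le_polylog q (by positivity)

namespace Run.IsXODO

variable [∀ s, Fintype (A s)] {G : Game A} {rm : Population A → ℕ → Profile A} {r : Run A}
  (hr : r.IsXODO G rm) [Fintype S] {c : ℝ} {p : ℕ}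
include hr

theorem isStrategy_overallAverage (hrm : IsRegretMinimizer G c p rm) {T : ℕ} (hT : 1 ≤ T) :
    IsStrategy (r.overallAverage G T) :=
  G.isStrategy_average (fun _ ht => hr.isStrategy_strat hrm (Finset.mem_Icc.1 ht).1)
    ⟨1, Finset.mem_Icc.2 ⟨le_rfl, hT⟩⟩

/-- If the number of samples is at least the bound, the number `T` of iterations is large enough
for the regret to drop to `ε / 2` per round, since an iteration uses at most `2 X` samples. -/
theorem isNash_of_sampleBound_le (hrm : IsRegretMinimizer G c p rm) (hc : 0 ≤ c) {Δ : ℝ}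
    (hΔ : ∀ x ∈ G.root.payoffs, ∀ y ∈ G.root.payoffs, x - y ≤ Δ) {C ε : ℝ} {q : ℕ} (hε : 0 < ε)
    (hC : ∀ k X T : ℝ, 1 ≤ k → 1 ≤ X → C * (k ^ 2 * X ^ 2 / ε ^ 2) * polylog q (k * X / ε) ≤ T →
      2 * (k * Δ + c * k * X * √T * polylog p (X * k * T)) ≤ ε * T)
    {T : ℕ} (hT : 1 ≤ T)
    (h : sampleBound C q ε (r.numWindows T) (G.size (r.pop T)) ≤ r.samples G (fun _ => 1) T) :
    G.IsNash ε (r.overallAverage G T) := by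
  by_cases h0 : G.size (r.pop T) = 0
  · exact G.isNash_of_visited_eq_empty (G.visited_eq_empty_of_size_eq_zero h0) hε
      (hr.isStrategy_overallAverage hrm hT)
  have hX : (1 : ℝ) ≤ G.size (r.pop T) := by exact_mod_cast Nat.one_le_iff_ne_zero.2 h0
  have hk : (1 : ℝ) ≤ r.numWindows T := by exact_mod_cast hr.one_le_numWindows hT
  refine G.isNash_average (fun _ ht => hr.isStrategy_strat hrm (Finset.mem_Icc.1 ht).1)
    ⟨1, Finset.mem_Icc.2 ⟨le_rfl, hT⟩⟩ (fun i π hπ => hr.regret_le hrm hc hΔ hT i hπ) ?_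
  rw [Nat.card_Icc, Nat.add_sub_cancel]
  refine hC _ _ _ hk hX ?_
  have hle : (r.samples G (fun _ => 1) T : ℝ) ≤ 2 * T * G.size (r.pop T) := by
    exact_mod_cast hr.samples_le T
  refine le_of_mul_le_mul_left (a := 2 * (G.size (r.pop T) : ℝ)) ?_ (by linarith)
  calc _ = sampleBound C q ε (r.numWindows T) (G.size (r.pop T)) := by
        rw [sampleBound]; ring
    _ ≤ 2 * T * G.size (r.pop T) := h.trans hle
    _ = _ := by ring

/-- The bound stays bounded in the course of the execution while the number of samples grows at
least linearly, unless the game has no information sets. -/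
theorem exists_sampleBound_le_samples (h0 : G.size (r.pop 1) ≠ 0) {C ε : ℝ} (q : ℕ) (hC : 0 ≤ C)
    (hε : 0 < ε) : ∃ T, 1 ≤ T ∧
      sampleBound C q ε (r.numWindows T) (G.size (r.pop T)) ≤ r.samples G (fun _ => 1) T := by
  obtain ⟨n, hn⟩ := exists_nat_ge (sampleBound C q ε
    ((∑ s, Fintype.card (A s) + 1 : ℕ) : ℝ) (G.size fun s => (Set.univ : Set (A s))))
  refine ⟨n + 1, by omega, ?_⟩
  have h1 : n ≤ r.samples G (fun _ => 1) (n + 1) := by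
    have := hr.mul_size_le_samples (n + 1)
    have := Nat.one_le_iff_ne_zero.2 h0
    nlinarith
  calc _ ≤ _ := sampleBound_mono q hC hε (Nat.cast_nonneg _) (Nat.cast_nonneg _)
        (Nat.cast_le.2 (hr.numWindows_le (by omega)))
        (Nat.cast_le.2 (G.size_mono fun s => Set.subset_univ _))
    _ ≤ (n : ℝ) := hn
    _ ≤ _ := Nat.cast_le.2 h1

/-- If the bound with the constant `C` guarantees an `ε`-Nash equilibrium, then the first one is
found within the bound with the constant `C + Δ ^ 2`: the second term pays for the samples of the
last iteration. -/
theorem exists_isLeast_isNash (hrm : IsRegretMinimizer G c p rm) {C Δ ε : ℝ} (q : ℕ) (hC : 0 ≤ C)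
    (hε : 0 < ε) (hεΔ : ε ≤ Δ)
    (hN : ∀ T, 1 ≤ T →
      sampleBound C q ε (r.numWindows T) (G.size (r.pop T)) ≤ r.samples G (fun _ => 1) T →
        G.IsNash ε (r.overallAverage G T)) :
    ∃ T, IsLeast {T : ℕ | 1 ≤ T ∧ G.IsNash ε (r.overallAverage G T)} T ∧
      (r.samples G (fun _ => 1) T : ℝ) ≤
        sampleBound (C + Δ ^ 2) q ε (r.numWindows T) (G.size (r.pop T)) := by
  by_cases h0 : G.size (r.pop 1) = 0
  · refine ⟨1, ⟨⟨le_rfl, G.isNash_of_visited_eq_empty (G.visited_eq_empty_of_size_eq_zero h0) hε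
      (hr.isStrategy_overallAverage hrm le_rfl)⟩, fun T hT => hT.1⟩, ?_⟩
    have h1 : r.samples G (fun _ => 1) 1 = 0 := by
      rw [samples_one]; simp [h0]
    rw [h1, Nat.cast_zero]
    exact sampleBound_nonneg q (by positivity) hε (Nat.cast_nonneg _) (Nat.cast_nonneg _)
  · obtain ⟨T₀, hT₀, hb⟩ := hr.exists_sampleBound_le_samples h0 q hC hε
    have hex : ∃ T, 1 ≤ T ∧ G.IsNash ε (r.overallAverage G T) := ⟨T₀, hT₀, hN T₀ hT₀ hb⟩
    classical
    obtain ⟨T, hT, hmin⟩ : ∃ T, (1 ≤ T ∧ G.IsNash ε (r.overallAverage G T)) ∧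
        ∀ n, 1 ≤ n → G.IsNash ε (r.overallAverage G n) → T ≤ n :=
      ⟨Nat.find hex, Nat.find_spec hex, fun n h1 h2 => Nat.find_min' hex ⟨h1, h2⟩⟩
    refine ⟨T, ⟨hT, fun n hn => hmin n hn.1 hn.2⟩, ?_⟩
    have hX : (1 : ℝ) ≤ G.size (r.pop T) := by
      exact_mod_cast Nat.one_le_iff_ne_zero.2 fun h => h0 (G.size_eq_zero_of_size_eq_zero _ h)
    have hk : (1 : ℝ) ≤ r.numWindows T := by exact_mod_cast hr.one_le_numWindows hT.1
    have hlast := two_mul_le_sampleBound q hε hεΔ hk hX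
    obtain ⟨n, rfl⟩ := Nat.exists_eq_add_of_le' hT.1
    have hsucc : r.samples G (fun _ => 1) (n + 1) =
        r.samples G (fun _ => 1) n + 2 * G.size (r.pop (n + 1)) := by
      rw [samples_one, samples_one, Finset.sum_Icc_succ_top (by omega)]
    have hprev : (r.samples G (fun _ => 1) n : ℝ) ≤
        sampleBound C q ε (r.numWindows (n + 1)) (G.size (r.pop (n + 1))) := by
      obtain rfl | hn := Nat.eq_zero_or_pos n
      · rw [samples_one]
        simpa using sampleBound_nonneg q hC hε (Nat.cast_nonneg _) (Nat.cast_nonneg _)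
      · have hlt := lt_of_not_ge fun h => absurd (hmin n hn (hN n hn h)) (by omega)
        exact hlt.le.trans (sampleBound_mono q hC hε (Nat.cast_nonneg _) (Nat.cast_nonneg _)
          (Nat.cast_le.2 (hr.numWindows_mono hn (by omega)))
          (Nat.cast_le.2 (G.size_mono (hr.pop_mono hn (by omega)))))
    rw [hsucc, sampleBound_add]
    push_cast
    linarith

end Run.IsXODO

end DoubleOracle

theorem mainTheorem7 :
    (∀ (S : Type u) (A : S → Type v) [∀ s, Fintype (A s)] (G : DoubleOracle.Game A)
        (rm : DoubleOracle.Population A → ℕ → DoubleOracle.Profile A) (r : DoubleOracle.Run A),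
        r.IsXODO G rm ↔ r.IsRMDO G rm (fun _ => 1)) ∧
    ∀ (c Δ : ℝ) (p : ℕ), 0 < c → 0 < Δ →
      ∃ (C : ℝ) (q : ℕ), 0 < C ∧
        ∀ (S : Type u) [Fintype S] (A : S → Type v) [∀ s, Fintype (A s)] [∀ s, Nonempty (A s)]
          (G : DoubleOracle.Game A),
          (∀ x ∈ G.root.payoffs, ∀ y ∈ G.root.payoffs, x - y ≤ Δ) →
          ∀ rm : DoubleOracle.Population A → ℕ → DoubleOracle.Profile A,
            DoubleOracle.IsRegretMinimizer G c p rm →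
          ∀ r : DoubleOracle.Run A, r.IsXODO G rm →
          ∀ ε : ℝ, 0 < ε → ε ≤ Δ →
            (∀ T : ℕ, 1 ≤ T →
              C * (2 * (r.numWindows T : ℝ) ^ 2 * (G.size (r.pop T) : ℝ) ^ 3 / ε ^ 2) *
                  DoubleOracle.polylog q (r.numWindows T * G.size (r.pop T) / ε) ≤
                r.samples G (fun _ => 1) T →
              G.IsNash ε (r.overallAverage G T)) ∧
            ∃ T : ℕ, IsLeast {T : ℕ | 1 ≤ T ∧ G.IsNash ε (r.overallAverage G T)} T ∧
              (r.samples G (fun _ => 1) T : ℝ) ≤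
                C * (2 * (r.numWindows T : ℝ) ^ 2 * (G.size (r.pop T) : ℝ) ^ 3 / ε ^ 2) *
                  DoubleOracle.polylog q (r.numWindows T * G.size (r.pop T) / ε) := by
  refine ⟨fun S A _ G rm r => DoubleOracle.Run.isXODO_iff_isRMDO_one, fun c Δ p hc hΔ => ?_⟩
  obtain ⟨C, q, hC, hT⟩ := DoubleOracle.exists_rounds_bound c Δ hc hΔ p
  refine ⟨C + Δ ^ 2, q, by positivity, fun S _ A _ _ G hG rm hrm r hr ε hε hεΔ => ?_⟩
  have hN : ∀ T, 1 ≤ T →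
      DoubleOracle.sampleBound C q ε (r.numWindows T) (G.size (r.pop T)) ≤
        r.samples G (fun _ => 1) T → G.IsNash ε (r.overallAverage G T) := fun T h1 =>
    hr.isNash_of_sampleBound_le hrm hc.le hG hε
      (fun k X T hk hX => hT k X T ε hk hX hε hεΔ) h1
  refine ⟨fun T h1 h2 => hN T h1 (le_trans ?_ h2), hr.exists_isLeast_isNash hrm q hC.le hε hεΔ hN⟩
  have := DoubleOracle.sampleBound_nonneg q (sq_nonneg Δ) hε
    (Nat.cast_nonneg (r.numWindows T)) (Nat.cast_nonneg (G.size (r.pop T)))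
  exact (le_add_of_nonneg_right this).trans (DoubleOracle.sampleBound_add _ _ _ _ _ _).ge
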